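/- Setting. There are $n$ parties and $f<n/3$; an asynchronous network; an adversary that may adaptively corrupt up to $f$ parties in total (a party is nonfaulty until it is corrupted; a static adversary is a special case). Parties communicate by broadcast channels, each with a designated dealer, that satisfy the reliable-broadcast properties. *Validity*: if the dealer is nonfaulty, the values output by nonfaulty parties are the dealer's input. *Agreement*: any two values output by nonfaulty parties are equal. *Termination*: if the dealer stays nonfaulty and has an input, or if some nonfaulty party has output a value, then every party that stays nonfaulty eventually outputs a value. A validated broadcast satisfies moreover *External Validity*: values $x$ output by nonfaulty parties satisfy $\mathsf{validate}(x)=1$, where $\mathsf{validate}:\mathcal M\to\{0,1\}$ is a given function. A *gather-set* is a set of at least $n-f$ pairs $(j,x)\in[n]\times\mathcal M$ in which each index $j$ appears at most once; $\mathrm{Indices}(X)=\{j:\exists x,\,(j,x)\in X\}$. Protocol $\mathsf{Gather}_i(x_i)$. Party $i$ starts with $R_i=S_i=T_i=U_i=\emptyset$ and a validated broadcast of $\langle 1,x_i\rangle$. Upon receiving $\langle 1,x_j\rangle$ from $j$, it adds $(j,x_j)$ to $R_i$ and $j$ to $S_i$, and if now $|S_i|=n-f$ it broadcasts $\langle 2,S_i\rangle$.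 Upon having received $\langle 2,S_j\rangle$ from $j$ with $|S_j|\ge n-f$ and $S_j\subseteq S_i$, it adds $j$ to $T_i$, and if now $|T_i|=n-f$ it broadcasts $\langle 3,T_i\rangle$. Upon having received $\langle 3,T_j\rangle$ from $j$ with $|T_j|\ge n-f$ and $T_j\subseteq T_i$, it adds $(j,\bigcup_{k\in T_j}S_k)$ to $U_i$ (and is said to have accepted $\langle 3,T_j\rangle$), and if now $|U_i|=n-f$ it outputs $R_i$; it continues to update its state after that. Protocol $\mathsf{GatherVerify}_i(I)$, for $I\subseteq[n]$: wait until $|\{j:\exists (j,V_j)\in U_i,\ V_j\subseteq I\}|\ge n-f$ and $I\subseteq S_i$, then output $\{(j,x)\in R_i: j\in I\}$ and terminate. Theorem. Let $f<n/3$ and let the inputs of all nonfaulty parties be externally valid. Then $(\mathsf{Gather},\mathsf{GatherVerify})$ is a verifiable gather protocol resilient to $f$ Byzantine parties. That is, sets output by nonfaulty parties from $\mathsf{Gather}$ are gather-sets, a set output by a nonfaulty party from $\mathsf{GatherVerify}(I)$ is a gather-set with index-set $I$, and the following hold. (1) At the time at which the first nonfaulty party outputs a value from $\mathsf{Gather}$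 there is a gather-set $X^*$, determined by the execution up to that time, such that, however the execution continues: *Binding Core*: if a nonfaulty party outputs $X$ from $\mathsf{Gather}$, then $X^*\subseteq X$; *Internal Validity*: if $(j,x)\in X^*$ and $j$ is nonfaulty at that time, then $x$ is the input of $j$; *Includes Core*: if $\mathsf{GatherVerify}_i(I)$ terminates with output $X$ at a nonfaulty party $i$, then $X^*\subseteq X$. (2) If all nonfaulty parties start $\mathsf{Gather}$, then: *Termination of Output*: every party that stays nonfaulty eventually outputs a gather-set; *Completeness*: if $j$, while nonfaulty, outputs $X_j$ from $\mathsf{Gather}$ and $i$ stays nonfaulty, then $\mathsf{GatherVerify}_i(\mathrm{Indices}(X_j))$ eventually terminates with output $X_j$; *Agreement on Verification*: if $\mathsf{GatherVerify}_i(I)$ terminates with output $X$ at a nonfaulty party $i$ and $j$ stays nonfaulty, then $\mathsf{GatherVerify}_j(I)$ eventually terminates with output $X$. (3) *Agreement*: if $\mathsf{GatherVerify}_i(I)$ and $\mathsf{GatherVerify}_j(J)$ terminate with outputs $X$ and $Y$ at nonfaulty parties $i,j$, and $(k,x)\in X$, $(k,y)\in Y$, then $x=y$. *External Validity*: if $\mathsf{GatherVerify}_i(I)$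 terminates with output $X$ at a nonfaulty party $i$, then $\mathsf{validate}(x)=1$ for all $(j,x)\in X$. Moreover $(n-f)^2>nf$, and if a nonfaulty party $p$ has output a value from $\mathsf{Gather}$, then there is an index $i^*$ such that for at least $f+1$ parties $k$, $p$ has accepted a message $\langle 3,T_k\rangle$ broadcast by $k$ with $i^*\in T_k$. -/

import Mathlib

namespace VerifiableGather

universe u

/-! ### Broadcast channels -/

/-- What is visible, over (discrete, global) time, of one instance of a broadcast protocol among
`n` parties: the parties corrupted so far, the input the dealer has given to the instance so far
(`none` before it has given one), and the value that each party has output so far. Corruption may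
be adaptive, and the entries of a party are meaningful at the times at which it is nonfaulty. -/
structure BroadcastTrace (n : ℕ) (V : Type u) where
  dealer : Fin n
  faulty : ℕ → Finset (Fin n)
  dealerInput : ℕ → Option V
  output : ℕ → Fin n → Option V

namespace BroadcastTrace

variable {n : ℕ} {V : Type u}

/-- While the dealer is nonfaulty, every value output by a nonfaulty party is the input that the
dealer has given. -/
def Validity (B : BroadcastTrace n V) : Prop :=
  ∀ t i v, i ∉ B.faulty t → B.dealer ∉ B.faulty t → B.output t i = some v →
    B.dealerInput t = some v

/-- Any two values output by nonfaulty parties are the same. -/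
def Agreement (B : BroadcastTrace n V) : Prop :=
  ∀ t t' i i' v v', i ∉ B.faulty t → i' ∉ B.faulty t' →
    B.output t i = some v → B.output t' i' = some v' → v = v'

/-- If the dealer is (forever) nonfaulty and gives an input, or if some nonfaulty party outputs
a value, then every party that stays nonfaulty eventually outputs a value. -/
def Termination (B : BroadcastTrace n V) : Prop :=
  (((∀ t, B.dealer ∉ B.faulty t) ∧ ∃ t v, B.dealerInput t = some v) ∨
      ∃ t i v, i ∉ B.faulty t ∧ B.output t i = some v) →
    ∀ i, (∀ t, i ∉ B.faulty t) → ∃ t v, B.output t i = some v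

/-- Every value output by a nonfaulty party is externally valid. -/
def ExternalValidity (B : BroadcastTrace n V) (validate : V → Bool) : Prop :=
  ∀ t i v, i ∉ B.faulty t → B.output t i = some v → validate v = true

end BroadcastTrace

/-! ### Verifiable gather: the abstract notion -/

/-- The index-set of a set of pairs. -/
def indices {n : ℕ} {M : Type u} (X : Finset (Fin n × M)) : Finset (Fin n) :=
  X.image Prod.fst

/-- A gather-set: at least `n - f` pairs, each index appearing at most once. -/
structure IsGatherSet {n : ℕ} {M : Type u} (f : ℕ) (X : Finset (Fin n × M)) : Prop where
  large : n - f ≤ X.card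
  unique : ∀ j x y, (j, x) ∈ X → (j, y) ∈ X → x = y

/-- A pair of protocols `(Gather, Verify)` for `n` parties, given by its executions, as sequences
of global states. `input s i` is the input with which party `i` has started `Gather`, `output s i`
is what it has output from `Gather` so far, and `verify s i I` is the result of running
`Verify_i(I)` in the global state `s` (`none`: `Verify_i(I)` keeps waiting; running it changes no
state). `Run` are the possible executions (of any scheduling and adversary), `Fair` expresses
that messages and enabled actions of parties that stay nonfaulty are eventually processed. -/
structure GatherProtocol (n : ℕ) (M : Type u) where
  State : Type u
  faulty : State → Finset (Fin n)
  input : State → Fin n → Option M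
  output : State → Fin n → Option (Finset (Fin n × M))
  verify : State → Fin n → Finset (Fin n) → Option (Finset (Fin n × M))
  Run : (ℕ → State) → Prop
  Fair : (ℕ → State) → Prop

namespace GatherProtocol

variable {n : ℕ} {M : Type u} (P : GatherProtocol n M)

/-- An execution with at most `f` corruptions in which the inputs of nonfaulty parties are
externally valid. -/
structure Admissible (f : ℕ) (validate : M → Bool) (r : ℕ → P.State) : Prop where
  run : P.Run r
  corruptions : ∀ t, (P.faulty (r t)).card ≤ f
  validInputs : ∀ t i x, i ∉ P.faulty (r t) → P.input (r t) i = some x → validate x = true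

/-- Party `i` is never corrupted. -/
def StaysNonfaulty (r : ℕ → P.State) (i : Fin n) : Prop := ∀ t, i ∉ P.faulty (r t)

/-- All nonfaulty parties start `Gather`. -/
def AllStart (r : ℕ → P.State) : Prop :=
  ∀ i, P.StaysNonfaulty r i → ∃ t x, P.input (r t) i = some x

/-- At time `t` party `i` is nonfaulty and has output `X` from `Gather`. -/
def Outputs (r : ℕ → P.State) (t : ℕ) (i : Fin n) (X : Finset (Fin n × M)) : Prop :=
  i ∉ P.faulty (r t) ∧ P.output (r t) i = some X

/-- At time `t` party `i` is nonfaulty and `Verify_i(I)` terminates with output `X`. -/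
def Verifies (r : ℕ → P.State) (t : ℕ) (i : Fin n) (I : Finset (Fin n))
    (X : Finset (Fin n × M)) : Prop :=
  i ∉ P.faulty (r t) ∧ P.verify (r t) i I = some X

/-- `Verify_i(I)`, whenever it is called, eventually terminates with output `X`: from some time
on, running it yields `X`. -/
def EventuallyVerifies (r : ℕ → P.State) (i : Fin n) (I : Finset (Fin n))
    (X : Finset (Fin n × M)) : Prop :=
  ∃ t₀, ∀ t, t₀ ≤ t → P.verify (r t) i I = some X

/-- `t` is the time at which the first nonfaulty party has output a value from `Gather`. -/
def FirstOutput (r : ℕ → P.State) (t : ℕ) : Prop :=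
  (∃ i X, P.Outputs r t i X) ∧ ∀ t' < t, ∀ i X, ¬ P.Outputs r t' i X

/-- The executions `r` and `r'` are the same up to time `t`. -/
def SameUpTo (t : ℕ) (r r' : ℕ → P.State) : Prop := ∀ t', t' ≤ t → r' t' = r t'

/-- However the execution `r` goes on after time `t`, every gather-set output by a nonfaulty party
contains `C`. -/
def BindingCore (f : ℕ) (validate : M → Bool) (r : ℕ → P.State) (t : ℕ)
    (C : Finset (Fin n × M)) : Prop :=
  ∀ r', P.Admissible f validate r' → P.SameUpTo t r r' →
    ∀ t' i X, P.Outputs r' t' i X → C ⊆ X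

/-- However the execution `r` goes on after time `t`, every set output by `Verify` at a nonfaulty
party contains `C`. -/
def IncludesCore (f : ℕ) (validate : M → Bool) (r : ℕ → P.State) (t : ℕ)
    (C : Finset (Fin n × M)) : Prop :=
  ∀ r', P.Admissible f validate r' → P.SameUpTo t r r' →
    ∀ t' i I X, P.Verifies r' t' i I X → C ⊆ X

/-- The pairs of `C` whose index is nonfaulty at time `t` carry the input of that party. -/
def InternalValidity (r : ℕ → P.State) (t : ℕ) (C : Finset (Fin n × M)) : Prop :=
  ∀ j x, (j, x) ∈ C → j ∉ P.faulty (r t) → P.input (r t) j = some x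

end GatherProtocol

/-- `P` is a verifiable gather protocol resilient to `f` Byzantine parties. The core is chosen
at the time of the first output, before the rest of the execution. -/
structure IsVerifiableGather {n : ℕ} {M : Type u} (P : GatherProtocol n M) (f : ℕ)
    (validate : M → Bool) : Prop where
  output_isGatherSet : ∀ r, P.Admissible f validate r →
    ∀ t i X, P.Outputs r t i X → IsGatherSet f X
  verify_isGatherSet : ∀ r, P.Admissible f validate r →
    ∀ t i I X, P.Verifies r t i I X → IsGatherSet f X ∧ indices X = I
  core : ∀ r, P.Admissible f validate r → ∀ t, P.FirstOutput r t →
    ∃ C : Finset (Fin n × M), IsGatherSet f C ∧ P.BindingCore f validate r t C ∧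
      P.InternalValidity r t C ∧ P.IncludesCore f validate r t C
  termination : ∀ r, P.Admissible f validate r → P.Fair r → P.AllStart r →
    ∀ i, P.StaysNonfaulty r i → ∃ t X, P.Outputs r t i X
  completeness : ∀ r, P.Admissible f validate r → P.Fair r → P.AllStart r →
    ∀ i j t X, P.StaysNonfaulty r i → P.Outputs r t j X →
      P.EventuallyVerifies r i (indices X) X
  agreementOnVerification : ∀ r, P.Admissible f validate r → P.Fair r → P.AllStart r →
    ∀ i j t I X, P.Verifies r t i I X → P.StaysNonfaulty r j → P.EventuallyVerifies r j I X
  agreement : ∀ r, P.Admissible f validate r →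
    ∀ t t' i j I J X Y, P.Verifies r t i I X → P.Verifies r t' j J Y →
      ∀ k x y, (k, x) ∈ X → (k, y) ∈ Y → x = y
  externalValidity : ∀ r, P.Admissible f validate r →
    ∀ t i I X, P.Verifies r t i I X → ∀ j x, (j, x) ∈ X → validate x = true

/-! ### The protocol -/

/-- The local state of a party: its input (`none` before it starts), the messages it has
broadcast in the three rounds, the messages it has received by broadcast from each party in the
three rounds, the sets `R, S, T, U`, and its output. -/
structure LocalState (n : ℕ) (M : Type u) where
  input : Option M
  bcast1 : Option M
  bcast2 : Option (Finset (Fin n))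
  bcast3 : Option (Finset (Fin n))
  rcvd1 : Fin n → Option M
  rcvd2 : Fin n → Option (Finset (Fin n))
  rcvd3 : Fin n → Option (Finset (Fin n))
  R : Finset (Fin n × M)
  S : Finset (Fin n)
  T : Finset (Fin n)
  U : Finset (Fin n × Finset (Fin n))
  output : Option (Finset (Fin n × M))

namespace LocalState

variable {n : ℕ} {M : Type u}

def initial (n : ℕ) (M : Type u) : LocalState n M where
  input := none
  bcast1 := none
  bcast2 := none
  bcast3 := none
  rcvd1 := fun _ => none
  rcvd2 := fun _ => none
  rcvd3 := fun _ => none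
  R := ∅
  S := ∅
  T := ∅
  U := ∅
  output := none

/-- Start with input `x`: validated broadcast of `⟨1, x⟩`. -/
def start (x : M) (s : LocalState n M) : LocalState n M :=
  { s with input := some x, bcast1 := some x }

/-- Upon receiving `⟨1, x⟩` from `j`. -/
def receive1 [DecidableEq M] (f : ℕ) (j : Fin n) (x : M) (s : LocalState n M) :
    LocalState n M :=
  { s with
    rcvd1 := Function.update s.rcvd1 j (some x)
    R := insert (j, x) s.R
    S := insert j s.S
    bcast2 := if (insert j s.S).card = n - f then some (insert j s.S) else s.bcast2 }

/-- Upon receiving `⟨2, A⟩` from `j`: keep it, waiting for it to be acceptable. -/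
def receive2 (j : Fin n) (A : Finset (Fin n)) (s : LocalState n M) : LocalState n M :=
  { s with rcvd2 := Function.update s.rcvd2 j (some A) }

/-- The message `⟨2, A⟩` received from `j` satisfies `n - f ≤ |A|` and `A ⊆ S`. -/
def Acceptable2 (f : ℕ) (s : LocalState n M) (j : Fin n) : Prop :=
  ∃ A, s.rcvd2 j = some A ∧ n - f ≤ A.card ∧ A ⊆ s.S

/-- Accept the round-2 message of `j`. -/
def accept2 (f : ℕ) (j : Fin n) (s : LocalState n M) : LocalState n M :=
  { s with
    T := insert j s.T
    bcast3 := if (insert j s.T).card = n - f then some (insert j s.T) else s.bcast3 }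

/-- Upon receiving `⟨3, A⟩` from `j`: keep it, waiting for it to be acceptable. -/
def receive3 (j : Fin n) (A : Finset (Fin n)) (s : LocalState n M) : LocalState n M :=
  { s with rcvd3 := Function.update s.rcvd3 j (some A) }

/-- The message `⟨3, A⟩` received from `j` satisfies `n - f ≤ |A|` and `A ⊆ T`. -/
def Acceptable3 (f : ℕ) (s : LocalState n M) (j : Fin n) (A : Finset (Fin n)) : Prop :=
  s.rcvd3 j = some A ∧ n - f ≤ A.card ∧ A ⊆ s.T

/-- The union of the round-2 sets received from the parties in `A`. -/
def unionOf (s : LocalState n M) (A : Finset (Fin n)) : Finset (Fin n) :=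
  A.biUnion fun k => (s.rcvd2 k).getD ∅

/-- Accept the round-3 message `⟨3, A⟩` of `j`. -/
def accept3 (f : ℕ) (j : Fin n) (A : Finset (Fin n)) (s : LocalState n M) : LocalState n M :=
  { s with
    U := insert (j, s.unionOf A) s.U
    output := if (insert (j, s.unionOf A) s.U).card = n - f then some s.R else s.output }

/-- `GatherVerify(I)`, run in the local state `s`. -/
def gatherVerify (f : ℕ) (s : LocalState n M) (I : Finset (Fin n)) :
    Option (Finset (Fin n × M)) :=
  if n - f ≤ (indices (s.U.filter fun p => p.2 ⊆ I)).card ∧ I ⊆ s.S then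
    some (s.R.filter fun p => p.1 ∈ I)
  else none

/-- One step of a party that follows `Gather`. Each broadcast is received at most once, each
received message is accepted at most once, and nothing is received before the start. -/
inductive Step [DecidableEq M] (f : ℕ) (s : LocalState n M) : LocalState n M → Prop
  | start (x : M) : s.input = none → Step f s (s.start x)
  | receive1 (j : Fin n) (x : M) : s.input ≠ none → s.rcvd1 j = none →
      Step f s (s.receive1 f j x)
  | receive2 (j : Fin n) (A : Finset (Fin n)) : s.input ≠ none → s.rcvd2 j = none →
      Step f s (s.receive2 j A)
  | accept2 (j : Fin n) : s.Acceptable2 f j → j ∉ s.T → Step f s (s.accept2 f j)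
  | receive3 (j : Fin n) (A : Finset (Fin n)) : s.input ≠ none → s.rcvd3 j = none →
      Step f s (s.receive3 j A)
  | accept3 (j : Fin n) (A : Finset (Fin n)) : s.Acceptable3 f j A → j ∉ indices s.U →
      Step f s (s.accept3 f j A)

end LocalState

/-- A global state: the corrupted parties and the local states (of a corrupted party: its last
state before the corruption). -/
structure GlobalState (n : ℕ) (M : Type u) where
  faulty : Finset (Fin n)
  party : Fin n → LocalState n M

namespace GlobalState

variable {n : ℕ} {M : Type u}

def initial (n : ℕ) (M : Type u) : GlobalState n M where
  faulty := ∅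
  party := fun _ => LocalState.initial n M

/-- A step of the system: a nonfaulty party takes a step, the adversary corrupts a party, or
nothing happens in the protocol. What corrupted parties do shows in the values that the
broadcasts of which they are the dealers deliver, which the steps leave open. -/
inductive Step [DecidableEq M] (f : ℕ) (s : GlobalState n M) : GlobalState n M → Prop
  | party (i : Fin n) (l : LocalState n M) : i ∉ s.faulty → (s.party i).Step f l →
      Step f s { s with party := Function.update s.party i l }
  | corrupt (i : Fin n) : Step f s { s with faulty := insert i s.faulty }
  | idle : Step f s s

end GlobalState

section Broadcasts

variable {n : ℕ} {M : Type u}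

/-- The round-1 (validated) broadcast of which `j` is the dealer. -/
def broadcast1 (r : ℕ → GlobalState n M) (j : Fin n) : BroadcastTrace n M where
  dealer := j
  faulty := fun t => (r t).faulty
  dealerInput := fun t => ((r t).party j).bcast1
  output := fun t i => ((r t).party i).rcvd1 j

/-- The round-2 broadcast of which `j` is the dealer. -/
def broadcast2 (r : ℕ → GlobalState n M) (j : Fin n) : BroadcastTrace n (Finset (Fin n)) where
  dealer := j
  faulty := fun t => (r t).faulty
  dealerInput := fun t => ((r t).party j).bcast2
  output := fun t i => ((r t).party i).rcvd2 j

/-- The round-3 broadcast of which `j` is the dealer. -/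
def broadcast3 (r : ℕ → GlobalState n M) (j : Fin n) : BroadcastTrace n (Finset (Fin n)) where
  dealer := j
  faulty := fun t => (r t).faulty
  dealerInput := fun t => ((r t).party j).bcast3
  output := fun t i => ((r t).party i).rcvd3 j

end Broadcasts

/-- An execution of `Gather` over broadcast channels: the initial state, a step at each time, and
the safety properties of (validated, in round 1) reliable broadcast. -/
structure IsGatherRun {n : ℕ} {M : Type u} [DecidableEq M] (f : ℕ) (validate : M → Bool)
    (r : ℕ → GlobalState n M) : Prop where
  initial : r 0 = GlobalState.initial n M
  step : ∀ t, (r t).Step f (r (t + 1))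
  validity1 : ∀ j, (broadcast1 r j).Validity
  agreement1 : ∀ j, (broadcast1 r j).Agreement
  externalValidity1 : ∀ j, (broadcast1 r j).ExternalValidity validate
  validity2 : ∀ j, (broadcast2 r j).Validity
  agreement2 : ∀ j, (broadcast2 r j).Agreement
  validity3 : ∀ j, (broadcast3 r j).Validity
  agreement3 : ∀ j, (broadcast3 r j).Agreement

/-- The liveness properties: the broadcasts terminate, and a party that stays nonfaulty
eventually accepts each acceptable message. -/
structure IsGatherFair {n : ℕ} {M : Type u} (f : ℕ) (r : ℕ → GlobalState n M) : Prop where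
  termination1 : ∀ j, (broadcast1 r j).Termination
  termination2 : ∀ j, (broadcast2 r j).Termination
  termination3 : ∀ j, (broadcast3 r j).Termination
  accept2 : ∀ i, (∀ t, i ∉ (r t).faulty) → ∀ t j, ((r t).party i).Acceptable2 f j →
    ∃ t', j ∈ ((r t').party i).T
  accept3 : ∀ i, (∀ t, i ∉ (r t).faulty) → ∀ t j A, ((r t).party i).Acceptable3 f j A →
    ∃ t', j ∈ indices ((r t').party i).U

/-- The pair `(Gather, GatherVerify)`. -/
def gather (n f : ℕ) {M : Type u} [DecidableEq M] (validate : M → Bool) :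
    GatherProtocol n M where
  State := GlobalState n M
  faulty := fun s => s.faulty
  input := fun s i => (s.party i).input
  output := fun s i => (s.party i).output
  verify := fun s i I => (s.party i).gatherVerify f I
  Run := IsGatherRun f validate
  Fair := IsGatherFair f

/-- In the local state `s`, at least `f + 1` parties are such that `s` has received and accepted
a message `⟨3, A⟩` from them with `i ∈ A`. -/
def InManyTSets {n : ℕ} {M : Type u} (f : ℕ) (s : LocalState n M) (i : Fin n) : Prop :=
  ∃ K : Finset (Fin n), f + 1 ≤ K.card ∧
    ∀ k ∈ K, k ∈ indices s.U ∧ ∃ A, s.rcvd3 k = some A ∧ i ∈ A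

end VerifiableGather

/-!
# `Gather` is a verifiable gather protocol

Everything about the outputs of `Gather` reduces to `GatherVerify`: a party outputs `R` at a moment
at which all the sets in its `U` are contained in `S = Indices(R)`, so that it can verify
`Indices(R)` itself from then on, with the same result (`LocalState.gatherVerify_indices_R`,
`LocalState.gatherVerify_mono`, `LocalState.Emits.output`).

The binding core rests on double counting. A party `p` that has output a value has accepted `n - f`
round-3 sets, each with at least `n - f` of the `n` indices. Since `(n - f) ^ 2 > n * f`, some index
`i` lies in `f + 1` of these sets (`exists_popular_index`). The core is what `p` has received in
round 1 from the members of the round-2 set `S_i`. All of this is fixed at that time, whatever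
happens to `p` afterwards. A party that verifies a set `I` has accepted `n - f` round-3 messages
whose unions lie in `I`. One of them is among the `f + 1`, and by agreement of the broadcasts it
carries the same set, which contains `i`; so `S_i ⊆ I` and the core is contained in what is
verified (`IsGatherRun.core_subset`).

For liveness, whatever a nonfaulty party has received is eventually received by every party that
stays nonfaulty, and so whatever is acceptable to the former is eventually accepted by the latter
(`IsGatherRun.eventually_subset_S`, `IsGatherRun.eventually_mem_T`, `IsGatherRun.eventually_mem_U`).
Therefore verification carries over from one party to another (`IsGatherRun.eventually_verify`), and
the at least `n - f` parties that are never corrupted bring each other through the three rounds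
(`IsGatherRun.exists_output`).
-/

namespace VerifiableGather

/-! ### Counting -/

section Counting

variable {n : ℕ}

theorem mul_lt_sub_sq {n f : ℕ} (hf : 3 * f < n) : n * f < (n - f) ^ 2 := by
  obtain ⟨m, rfl⟩ : ∃ m, n = m + f := ⟨n - f, by omega⟩
  have h : 2 * f + 1 ≤ m := by omega
  rw [Nat.add_sub_cancel]
  nlinarith

/-- Double counting: the sets `A k`, `k ∈ K`, have more than `n * f` elements in total, so one of
the `n` possible elements lies in more than `f` of them. -/
theorem exists_popular_index {f : ℕ} (hf : 3 * f < n) (K : Finset (Fin n))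
    (A : Fin n → Finset (Fin n)) (hK : n - f ≤ K.card) (hA : ∀ k ∈ K, n - f ≤ (A k).card) :
    ∃ i, f + 1 ≤ (K.filter fun k => i ∈ A k).card := by
  by_contra! h
  have h1 : ∑ i, (K.filter fun k => i ∈ A k).card = ∑ k ∈ K, (A k).card := by
    simpa [Finset.bipartiteAbove, Finset.bipartiteBelow] using
      Finset.sum_card_bipartiteAbove_eq_sum_card_bipartiteBelow
        (s := (Finset.univ : Finset (Fin n))) (t := K) (fun i k => i ∈ A k)
  have h2 : ∑ i, (K.filter fun k => i ∈ A k).card ≤ n * f := by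
    simpa using Finset.sum_le_card_nsmul Finset.univ
      (fun i => (K.filter fun k => i ∈ A k).card) f fun i _ => by
        have := h i
        omega
  have h3 : K.card * (n - f) ≤ ∑ k ∈ K, (A k).card := by
    simpa using Finset.card_nsmul_le_sum K (fun k => (A k).card) (n - f) hA
  have h4 := Nat.mul_le_mul_right (n - f) hK
  have h5 := mul_lt_sub_sq hf
  rw [sq] at h5
  omega

theorem exists_mem_inter_of_card {f : ℕ} {K L : Finset (Fin n)} (hK : f + 1 ≤ K.card)
    (hL : n - f ≤ L.card) : ∃ k, k ∈ K ∧ k ∈ L := by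
  by_contra! h
  have h1 : Disjoint K L := Finset.disjoint_left.2 h
  have h2 := Finset.card_le_univ (K ∪ L)
  rw [Finset.card_union_of_disjoint h1, Fintype.card_fin] at h2
  omega

theorem mem_indices {V : Type*} {X : Finset (Fin n × V)} {j : Fin n} :
    j ∈ indices X ↔ ∃ x, (j, x) ∈ X := by
  simp [indices]

end Counting

namespace LocalState

variable {n : ℕ} {M : Type*} {f : ℕ} {s s' : LocalState n M}

/-! ### Local invariants -/

/-- `s'` is a possible later state of a party than `s`: what has been received is kept, and the
sets `R, S, T, U` have only grown. -/
structure Le (s s' : LocalState n M) : Prop where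
  rcvd1 : ∀ j x, s.rcvd1 j = some x → s'.rcvd1 j = some x
  rcvd2 : ∀ j A, s.rcvd2 j = some A → s'.rcvd2 j = some A
  rcvd3 : ∀ j A, s.rcvd3 j = some A → s'.rcvd3 j = some A
  R : s.R ⊆ s'.R
  S : s.S ⊆ s'.S
  T : s.T ⊆ s'.T
  U : s.U ⊆ s'.U

theorem Le.refl (s : LocalState n M) : s.Le s :=
  ⟨fun _ _ h => h, fun _ _ h => h, fun _ _ h => h, fun _ h => h, fun _ h => h, fun _ h => h,
    fun _ h => h⟩

theorem Le.trans {s'' : LocalState n M} (h : s.Le s') (h' : s'.Le s'') : s.Le s'' :=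
  ⟨fun j x e => h'.rcvd1 j x (h.rcvd1 j x e), fun j x e => h'.rcvd2 j x (h.rcvd2 j x e),
    fun j x e => h'.rcvd3 j x (h.rcvd3 j x e), h.R.trans h'.R, h.S.trans h'.S, h.T.trans h'.T,
    h.U.trans h'.U⟩

theorem update_eq_some_of_eq_none {V : Type*} {g : Fin n → Option V} {j k : Fin n} {v w : V}
    (hj : g j = none) (hk : g k = some w) : Function.update g j (some v) k = some w := by
  have : k ≠ j := by
    rintro rfl
    simp [hj] at hk
  rw [Function.update_of_ne this, hk]

theorem Step.le [DecidableEq M] (h : s.Step f s') : s.Le s' := by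
  cases h with
  | start x _ => exact ⟨fun _ _ h => h, fun _ _ h => h, fun _ _ h => h, fun _ h => h,
      fun _ h => h, fun _ h => h, fun _ h => h⟩
  | receive1 j x _ h => exact ⟨fun _ _ => update_eq_some_of_eq_none h, fun _ _ h => h,
      fun _ _ h => h, Finset.subset_insert _ _, Finset.subset_insert _ _, fun _ h => h,
      fun _ h => h⟩
  | receive2 j A _ h => exact ⟨fun _ _ h => h, fun _ _ => update_eq_some_of_eq_none h,
      fun _ _ h => h, fun _ h => h, fun _ h => h, fun _ h => h, fun _ h => h⟩
  | accept2 j _ _ => exact ⟨fun _ _ h => h, fun _ _ h => h, fun _ _ h => h, fun _ h => h,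
      fun _ h => h, Finset.subset_insert _ _, fun _ h => h⟩
  | receive3 j A _ h => exact ⟨fun _ _ h => h, fun _ _ h => h,
      fun _ _ => update_eq_some_of_eq_none h, fun _ h => h, fun _ h => h, fun _ h => h,
      fun _ h => h⟩
  | accept3 j A _ _ => exact ⟨fun _ _ h => h, fun _ _ h => h, fun _ _ h => h, fun _ h => h,
      fun _ h => h, fun _ h => h, Finset.subset_insert _ _⟩

theorem Acceptable2.mono (h : s.Le s') {j : Fin n} (hj : s.Acceptable2 f j) :
    s'.Acceptable2 f j := by
  obtain ⟨A, h1, h2, h3⟩ := hj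
  exact ⟨A, h.rcvd2 _ _ h1, h2, h3.trans h.S⟩

theorem Acceptable3.mono (h : s.Le s') {j : Fin n} {A : Finset (Fin n)}
    (hj : s.Acceptable3 f j A) : s'.Acceptable3 f j A :=
  ⟨h.rcvd3 _ _ hj.1, hj.2.1, hj.2.2.trans h.T⟩

/-- The sets `R, S, T, U` record received messages: `R` and `S` all those of round 1, `T` and `U`
only acceptable ones. -/
structure WellFormed (f : ℕ) (s : LocalState n M) : Prop where
  mem_R : ∀ j x, (j, x) ∈ s.R ↔ s.rcvd1 j = some x
  mem_S : ∀ j, j ∈ s.S ↔ ∃ x, s.rcvd1 j = some x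
  mem_T : ∀ j ∈ s.T, s.Acceptable2 f j
  mem_U : ∀ j V, (j, V) ∈ s.U → ∃ A, s.Acceptable3 f j A ∧ V = s.unionOf A

/-- The sets broadcast in round 2 for the members of `A` are known once `A ⊆ T`, so that their
union does not change any more. -/
theorem unionOf_eq_of_rcvd2_eq {A : Finset (Fin n)} (hA : A ⊆ s.T) (hs : s.WellFormed f)
    (h : ∀ k ∈ A, ∀ B, s.rcvd2 k = some B → s'.rcvd2 k = some B) :
    s'.unionOf A = s.unionOf A := by
  refine Finset.biUnion_congr rfl fun k hk => ?_
  obtain ⟨B, hB, -⟩ := hs.mem_T k (hA hk)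
  rw [hB, h k hk B hB]

theorem subset_unionOf {A B : Finset (Fin n)} {k : Fin n} (hk : k ∈ A)
    (hB : s.rcvd2 k = some B) : B ⊆ s.unionOf A := by
  have := Finset.subset_biUnion_of_mem (fun k => (s.rcvd2 k).getD ∅) hk
  simpa [unionOf, hB] using this

namespace WellFormed

theorem indices_R (hs : s.WellFormed f) : indices s.R = s.S := by
  ext j
  simp [mem_indices, hs.mem_R, hs.mem_S]

theorem unionOf_subset (hs : s.WellFormed f) {A : Finset (Fin n)} (hA : A ⊆ s.T) :
    s.unionOf A ⊆ s.S := by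
  refine Finset.biUnion_subset.2 fun k hk => ?_
  obtain ⟨B, hB, -, h⟩ := hs.mem_T k (hA hk)
  simpa [hB] using h

theorem card_indices_U (hs : s.WellFormed f) : (indices s.U).card = s.U.card := by
  refine Finset.card_image_of_injOn ?_
  rintro ⟨j, V⟩ hV ⟨j', V'⟩ hV' (rfl : j = j')
  obtain ⟨A, hA, rfl⟩ := hs.mem_U _ _ hV
  obtain ⟨A', hA', rfl⟩ := hs.mem_U _ _ hV'
  obtain rfl : A = A' := Option.some.inj (hA.1.symm.trans hA'.1)
  rfl

theorem initial : (LocalState.initial n M).WellFormed f := by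
  constructor <;> simp [LocalState.initial]

theorem step [DecidableEq M] (hs : s.WellFormed f) (h : s.Step f s') : s'.WellFormed f := by
  have hle := h.le
  have hT : ∀ j ∈ s.T, s'.Acceptable2 f j := fun j hj => (hs.mem_T j hj).mono hle
  have hU : ∀ j V, (j, V) ∈ s.U → ∃ A, s'.Acceptable3 f j A ∧ V = s'.unionOf A := by
    intro j V hV
    obtain ⟨A, hA, rfl⟩ := hs.mem_U j V hV
    exact ⟨A, hA.mono hle, (unionOf_eq_of_rcvd2_eq hA.2.2 hs fun k _ => hle.rcvd2 k).symm⟩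
  cases h with
  | start x _ => exact ⟨hs.mem_R, hs.mem_S, hT, hU⟩
  | receive1 j x _ hj =>
    refine ⟨fun k y => ?_, fun k => ?_, hT, hU⟩
    · by_cases hk : k = j
      · subst hk
        simp [LocalState.receive1, hs.mem_R, hj, eq_comm]
      · simp [LocalState.receive1, hs.mem_R, hk]
    · by_cases hk : k = j
      · subst hk
        simp [LocalState.receive1]
      · simp [LocalState.receive1, hs.mem_S, hk]
  | receive2 j A _ _ => exact ⟨hs.mem_R, hs.mem_S, hT, hU⟩
  | accept2 j hj _ =>
    refine ⟨hs.mem_R, hs.mem_S, fun k hk => ?_, hU⟩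
    rcases Finset.mem_insert.1 hk with rfl | hk
    · exact hj.mono hle
    · exact hT k hk
  | receive3 j A _ _ => exact ⟨hs.mem_R, hs.mem_S, hT, hU⟩
  | accept3 j A hj _ =>
    refine ⟨hs.mem_R, hs.mem_S, hT, fun k V hk => ?_⟩
    rcases Finset.mem_insert.1 hk with hk | hk
    · obtain ⟨rfl, rfl⟩ := Prod.mk.inj hk
      exact ⟨A, hj.mono hle, rfl⟩
    · exact hU k V hk

end WellFormed

theorem gatherVerify_eq_some {I : Finset (Fin n)} {X : Finset (Fin n × M)} :
    s.gatherVerify f I = some X ↔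
      n - f ≤ (indices (s.U.filter fun p => p.2 ⊆ I)).card ∧ I ⊆ s.S ∧
        s.R.filter (fun p => p.1 ∈ I) = X := by
  unfold gatherVerify
  split_ifs with h
  · simp [h]
  · exact ⟨fun h' => by simp at h', fun h' => absurd ⟨h'.1, h'.2.1⟩ h⟩

theorem mem_of_gatherVerify (hs : s.WellFormed f) {I : Finset (Fin n)} {X : Finset (Fin n × M)}
    (h : s.gatherVerify f I = some X) {j : Fin n} {x : M} :
    (j, x) ∈ X ↔ s.rcvd1 j = some x ∧ j ∈ I := by
  rw [gatherVerify_eq_some] at h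
  rw [← h.2.2, Finset.mem_filter, hs.mem_R]

theorem gatherVerify_mono (hle : s.Le s') (hs : s.WellFormed f) (hs' : s'.WellFormed f)
    {I : Finset (Fin n)} {X : Finset (Fin n × M)} (h : s.gatherVerify f I = some X) :
    s'.gatherVerify f I = some X := by
  obtain ⟨h1, h2, rfl⟩ := gatherVerify_eq_some.1 h
  refine gatherVerify_eq_some.2 ⟨h1.trans (Finset.card_le_card ?_), h2.trans hle.S, ?_⟩
  · exact Finset.image_subset_image (Finset.filter_subset_filter _ hle.U)
  · ext ⟨j, x⟩
    simp only [Finset.mem_filter, hs.mem_R, hs'.mem_R, and_congr_left_iff]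
    intro hj
    refine ⟨fun hx => ?_, hle.rcvd1 j x⟩
    obtain ⟨y, hy⟩ := (hs.mem_S j).1 (h2 hj)
    rw [← hx, hle.rcvd1 j y hy, hy]

/-- At the moment at which a party outputs `R`, all the sets in `U` are contained in
`S = Indices(R)`. -/
theorem gatherVerify_indices_R (hs : s.WellFormed f) (hU : n - f ≤ s.U.card) :
    s.gatherVerify f (indices s.R) = some s.R := by
  refine gatherVerify_eq_some.2 ⟨?_, hs.indices_R.subset, ?_⟩
  · rw [Finset.filter_true_of_mem, hs.card_indices_U]
    · exact hU
    · rintro ⟨j, V⟩ hV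
      obtain ⟨A, hA, rfl⟩ := hs.mem_U j V hV
      rw [hs.indices_R]
      exact hs.unionOf_subset hA.2.2
  · exact Finset.filter_true_of_mem fun p hp => Finset.mem_image_of_mem _ hp

theorem isGatherSet_of_gatherVerify (hf : f < n) (hs : s.WellFormed f) {I : Finset (Fin n)}
    {X : Finset (Fin n × M)} (h : s.gatherVerify f I = some X) :
    IsGatherSet f X ∧ indices X = I := by
  obtain ⟨h1, h2, -⟩ := gatherVerify_eq_some.1 h
  have hX : indices X = I := by
    ext j
    simp only [mem_indices, mem_of_gatherVerify hs h, exists_and_right, and_iff_right_iff_imp]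
    exact fun hj => (hs.mem_S j).1 (h2 hj)
  refine ⟨⟨?_, fun j x y hx hy => ?_⟩, hX⟩
  -- Some `(k, V) ∈ U` has `V ⊆ I`, and `V` contains a round-2 set, which has `n - f` elements.
  · obtain ⟨k, hk⟩ : (indices (s.U.filter fun p => p.2 ⊆ I)).Nonempty :=
      Finset.card_pos.1 (by omega)
    obtain ⟨V, hV⟩ := mem_indices.1 hk
    obtain ⟨hV, hVI⟩ := Finset.mem_filter.1 hV
    obtain ⟨A, ⟨-, hAc, hAT⟩, rfl⟩ := hs.mem_U k V hV
    obtain ⟨l, hl⟩ : A.Nonempty := Finset.card_pos.1 (by omega)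
    obtain ⟨B, hB, hBc, -⟩ := hs.mem_T l (hAT hl)
    calc n - f ≤ B.card := hBc
      _ ≤ I.card := Finset.card_le_card ((subset_unionOf hl hB).trans hVI)
      _ = (indices X).card := by rw [hX]
      _ ≤ X.card := Finset.card_image_le
  · rw [mem_of_gatherVerify hs h] at hx hy
    exact Option.some.inj (hx.1.symm.trans hy.1)

/-- What a party has emitted: the broadcasts of rounds 2 and 3 and the output are there as soon as
`S`, `T` and `U` have `n - f` elements, the sets broadcast are contained in `S` and `T`, and a
set that has been output can be verified by the party itself. -/
structure Emits (f : ℕ) (s : LocalState n M) : Prop where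
  bcast1 : s.bcast1 = s.input
  bcast2_isSome : n - f ≤ s.S.card → ∃ A, s.bcast2 = some A
  bcast2 : ∀ A, s.bcast2 = some A → n - f ≤ A.card ∧ A ⊆ s.S
  bcast3_isSome : n - f ≤ s.T.card → ∃ A, s.bcast3 = some A
  bcast3 : ∀ A, s.bcast3 = some A → n - f ≤ A.card ∧ A ⊆ s.T
  output_isSome : n - f ≤ s.U.card → ∃ X, s.output = some X
  output : ∀ X, s.output = some X → s.gatherVerify f (indices X) = some X

/-- The rule "if now `|A| = m`, emit `A`" emits a value by the time that `|A| ≥ m`, as `A` grows by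
one element at a time. -/
theorem exists_ite_eq_some {α V : Type*} [DecidableEq α] {m : ℕ} {A : Finset α} {a : α}
    {v : V} {o : Option V} (ho : m ≤ A.card → ∃ w, o = some w) (h : m ≤ (insert a A).card) :
    ∃ w, (if (insert a A).card = m then some v else o) = some w := by
  split_ifs with h'
  · exact ⟨v, rfl⟩
  · have := Finset.card_insert_le a A
    exact ho (by omega)

namespace Emits

theorem initial (hf : f < n) : (LocalState.initial n M).Emits f := by
  have : n - f ≠ 0 := by omega
  constructor <;> simp [LocalState.initial, this]

theorem step [DecidableEq M] (he : s.Emits f) (hs : s.WellFormed f) (h : s.Step f s') :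
    s'.Emits f := by
  have hle := h.le
  have hs' := hs.step h
  have h2 : ∀ A, s.bcast2 = some A → n - f ≤ A.card ∧ A ⊆ s'.S := fun A hA =>
    ⟨(he.bcast2 A hA).1, (he.bcast2 A hA).2.trans hle.S⟩
  have h3 : ∀ A, s.bcast3 = some A → n - f ≤ A.card ∧ A ⊆ s'.T := fun A hA =>
    ⟨(he.bcast3 A hA).1, (he.bcast3 A hA).2.trans hle.T⟩
  have ho : ∀ X, s.output = some X → s'.gatherVerify f (indices X) = some X := fun X hX =>
    gatherVerify_mono hle hs hs' (he.output X hX)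
  cases h with
  | start x _ =>
    exact ⟨rfl, he.bcast2_isSome, h2, he.bcast3_isSome, h3, he.output_isSome, ho⟩
  | receive1 j x _ _ =>
    refine ⟨he.bcast1, exists_ite_eq_some he.bcast2_isSome, fun A hA => ?_, he.bcast3_isSome,
      h3, he.output_isSome, ho⟩
    simp only [LocalState.receive1] at hA
    split_ifs at hA with hc
    · obtain rfl := Option.some.inj hA
      exact ⟨hc.ge, fun _ h => h⟩
    · exact h2 A hA
  | receive2 j A _ _ =>
    exact ⟨he.bcast1, he.bcast2_isSome, h2, he.bcast3_isSome, h3, he.output_isSome, ho⟩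
  | accept2 j _ _ =>
    refine ⟨he.bcast1, he.bcast2_isSome, h2, exists_ite_eq_some he.bcast3_isSome,
      fun A hA => ?_, he.output_isSome, ho⟩
    simp only [LocalState.accept2] at hA
    split_ifs at hA with hc
    · obtain rfl := Option.some.inj hA
      exact ⟨hc.ge, fun _ h => h⟩
    · exact h3 A hA
  | receive3 j A _ _ =>
    exact ⟨he.bcast1, he.bcast2_isSome, h2, he.bcast3_isSome, h3, he.output_isSome, ho⟩
  | accept3 j A _ _ =>
    refine ⟨he.bcast1, he.bcast2_isSome, h2, he.bcast3_isSome, h3,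
      exists_ite_eq_some he.output_isSome, fun X hX => ?_⟩
    simp only [LocalState.accept3] at hX
    split_ifs at hX with hc
    · obtain rfl := Option.some.inj hX
      exact gatherVerify_indices_R hs' hc.ge
    · exact ho X hX

end Emits

/-- A party that has accepted `n - f` messages of round 3 has an index which occurs in `f + 1` of
them. -/
theorem WellFormed.exists_inManyTSets (hf : 3 * f < n) (hs : s.WellFormed f)
    (hU : n - f ≤ (indices s.U).card) : ∃ i, InManyTSets f s i := by
  have h : ∀ k ∈ indices s.U, ∃ A, s.Acceptable3 f k A := fun k hk => by
    obtain ⟨V, hV⟩ := mem_indices.1 hk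
    obtain ⟨A, hA, -⟩ := hs.mem_U k V hV
    exact ⟨A, hA⟩
  choose! A hA using h
  obtain ⟨i, hi⟩ := exists_popular_index hf _ A hU fun k hk => (hA k hk).2.1
  refine ⟨i, _, hi, fun k hk => ?_⟩
  obtain ⟨hk, hik⟩ := Finset.mem_filter.1 hk
  exact ⟨hk, A k, (hA k hk).1, hik⟩

theorem card_indices_U_of_gatherVerify {I : Finset (Fin n)} {X : Finset (Fin n × M)}
    (h : s.gatherVerify f I = some X) : n - f ≤ (indices s.U).card :=
  (gatherVerify_eq_some.1 h).1.trans
    (Finset.card_le_card (Finset.image_subset_image (Finset.filter_subset _ _)))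

end LocalState

/-! ### Safety -/

namespace IsGatherRun

open LocalState

variable {n : ℕ} {M : Type*} [DecidableEq M] {f : ℕ} {validate : M → Bool}
  {r : ℕ → GlobalState n M}

theorem party_step (hr : IsGatherRun f validate r) (t : ℕ) (i : Fin n) :
    (r (t + 1)).party i = (r t).party i ∨ ((r t).party i).Step f ((r (t + 1)).party i) := by
  have h := hr.step t
  generalize r (t + 1) = s' at h
  cases h with
  | party j l _ hl =>
    by_cases hij : i = j
    · subst hij
      simpa using Or.inr hl
    · simp [hij]
  | corrupt j => exact Or.inl rfl
  | idle => exact Or.inl rfl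

theorem faulty_mono (hr : IsGatherRun f validate r) : Monotone fun t => (r t).faulty := by
  refine monotone_nat_of_le_succ fun t => ?_
  have h := hr.step t
  generalize r (t + 1) = s' at h
  cases h with
  | party j l _ hl => exact le_rfl
  | corrupt j => exact Finset.subset_insert _ _
  | idle => exact le_rfl

theorem le (hr : IsGatherRun f validate r) (i : Fin n) {t t' : ℕ} (h : t ≤ t') :
    ((r t).party i).Le ((r t').party i) := by
  induction t', h using Nat.le_induction with
  | base => exact Le.refl _
  | succ t' _ ih =>
    rcases hr.party_step t' i with h | h
    · rwa [h]
    · exact ih.trans h.le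

theorem wellFormed (hr : IsGatherRun f validate r) (t : ℕ) (i : Fin n) :
    ((r t).party i).WellFormed f := by
  induction t with
  | zero =>
    rw [hr.initial]
    exact WellFormed.initial
  | succ t ih =>
    rcases hr.party_step t i with h | h
    · rwa [h]
    · exact ih.step h

theorem emits (hr : IsGatherRun f validate r) (hf : f < n) (t : ℕ) (i : Fin n) :
    ((r t).party i).Emits f := by
  induction t with
  | zero =>
    rw [hr.initial]
    exact Emits.initial hf
  | succ t ih =>
    rcases hr.party_step t i with h | h
    · rwa [h]
    · exact ih.step (hr.wellFormed t i) h

/-- Any two nonfaulty parties compute the same union for a set that both have accepted. -/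
theorem unionOf_eq (hr : IsGatherRun f validate r) {t t' : ℕ} {p q : Fin n}
    (hp : p ∉ (r t).faulty) (hq : q ∉ (r t').faulty) {A : Finset (Fin n)}
    (hA : A ⊆ ((r t).party p).T) (hA' : A ⊆ ((r t').party q).T) :
    ((r t').party q).unionOf A = ((r t).party p).unionOf A := by
  refine unionOf_eq_of_rcvd2_eq hA (hr.wellFormed t p) fun k hk B hB => ?_
  obtain ⟨B', hB', -⟩ := (hr.wellFormed t' q).mem_T k (hA' hk)
  rw [hB', hr.agreement2 k t' t q p B' B hq hp hB' hB]

theorem verify_agreement (hr : IsGatherRun f validate r) {t t' : ℕ} {p q : Fin n}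
    (hp : p ∉ (r t).faulty) (hq : q ∉ (r t').faulty) {I J : Finset (Fin n)}
    {X Y : Finset (Fin n × M)} (hX : ((r t).party p).gatherVerify f I = some X)
    (hY : ((r t').party q).gatherVerify f J = some Y) {k : Fin n} {x y : M}
    (hx : (k, x) ∈ X) (hy : (k, y) ∈ Y) : x = y :=
  hr.agreement1 k t t' p q x y hp hq
    ((mem_of_gatherVerify (hr.wellFormed t p) hX).1 hx).1
    ((mem_of_gatherVerify (hr.wellFormed t' q) hY).1 hy).1

/-- If nonfaulty `p` has accepted `f + 1` messages of round 3 that contain `i`, then every set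
verified by a nonfaulty party contains all that `p` has received in round 1 from the parties in
the round-2 set `B` of `i`. -/
theorem core_subset (hr : IsGatherRun f validate r) {t t' : ℕ} {p q i : Fin n}
    (hp : p ∉ (r t).faulty) (hq : q ∉ (r t').faulty) (hi : InManyTSets f ((r t).party p) i)
    {B : Finset (Fin n)} (hB : ((r t).party p).rcvd2 i = some B) {I : Finset (Fin n)}
    {X : Finset (Fin n × M)} (hX : ((r t').party q).gatherVerify f I = some X) :
    ((r t).party p).R.filter (fun y => y.1 ∈ B) ⊆ X := by
  obtain ⟨K, hKc, hK⟩ := hi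
  have hwp := hr.wellFormed t p
  have hwq := hr.wellFormed t' q
  obtain ⟨hU, hIS, -⟩ := gatherVerify_eq_some.1 hX
  -- `q` has accepted the message of one of the `f + 1` parties, with a union contained in `I`.
  obtain ⟨k, hkK, hkU⟩ := exists_mem_inter_of_card hKc hU
  obtain ⟨V, hV⟩ := mem_indices.1 hkU
  obtain ⟨hV, hVI⟩ := Finset.mem_filter.1 hV
  obtain ⟨A', hA', rfl⟩ := hwq.mem_U k V hV
  obtain ⟨-, A, hA, hiA⟩ := hK k hkK
  obtain rfl : A = A' := hr.agreement3 k t t' p q A A' hp hq hA hA'.1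
  obtain ⟨B', hB', -⟩ := hwq.mem_T i (hA'.2.2 hiA)
  obtain rfl : B = B' := hr.agreement2 i t t' p q B B' hp hq hB hB'
  have hBI : B ⊆ I := (subset_unionOf hiA hB').trans hVI
  rintro ⟨j, x⟩ hj
  obtain ⟨hx, hjB⟩ := Finset.mem_filter.1 hj
  obtain ⟨y, hy⟩ := (hwq.mem_S j).1 (hIS (hBI hjB))
  obtain rfl : x = y := hr.agreement1 j t t' p q x y hp hq ((hwp.mem_R j x).1 hx) hy
  exact (mem_of_gatherVerify hwq hX).2 ⟨hy, hBI hjB⟩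

end IsGatherRun

/-! ### Liveness -/

namespace BroadcastTrace

variable {n : ℕ} {V : Type*} {B : BroadcastTrace n V}

theorem eventually_output (hA : B.Agreement) (hT : B.Termination)
    (hmono : ∀ i v t t', t ≤ t' → B.output t i = some v → B.output t' i = some v)
    {t : ℕ} {p q : Fin n} {v : V} (hp : p ∉ B.faulty t) (hv : B.output t p = some v)
    (hq : ∀ t, q ∉ B.faulty t) : ∀ᶠ t' in Filter.atTop, B.output t' q = some v := by
  obtain ⟨t', v', hv'⟩ := hT (Or.inr ⟨t, p, v, hp, hv⟩) q hq
  obtain rfl := hA t t' p q v v' hp (hq t') hv hv'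
  exact Filter.eventually_atTop.2 ⟨t', fun t'' h => hmono _ _ _ _ h hv'⟩

theorem eventually_output_of_dealer (hV : B.Validity) (hT : B.Termination)
    (hmono : ∀ i v t t', t ≤ t' → B.output t i = some v → B.output t' i = some v)
    {q : Fin n} (hd : ∀ t, B.dealer ∉ B.faulty t) (hi : ∃ t v, B.dealerInput t = some v)
    (hq : ∀ t, q ∉ B.faulty t) :
    ∃ v t, B.dealerInput t = some v ∧ ∀ᶠ t' in Filter.atTop, B.output t' q = some v := by
  obtain ⟨t, v, hv⟩ := hT (Or.inl ⟨hd, hi⟩) q hq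
  exact ⟨v, t, hV t q v (hq t) (hd t) hv,
    Filter.eventually_atTop.2 ⟨t, fun t' h => hmono _ _ _ _ h hv⟩⟩

end BroadcastTrace

namespace IsGatherRun

open LocalState Filter

variable {n : ℕ} {M : Type*} [DecidableEq M] {f : ℕ} {validate : M → Bool}
  {r : ℕ → GlobalState n M}

/-- The parties that are never corrupted: by monotonicity of the set of corrupted parties at least
`n - f` of them. -/
theorem exists_nonfaulty (hr : IsGatherRun f validate r) (hc : ∀ t, (r t).faulty.card ≤ f) :
    ∃ H : Finset (Fin n), n - f ≤ H.card ∧ ∀ i ∈ H, ∀ t, i ∉ (r t).faulty := by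
  obtain ⟨t₀, h⟩ := WellFoundedGT.monotone_chain_condition ⟨_, hr.faulty_mono⟩
  refine ⟨(r t₀).faultyᶜ, ?_, fun i hi t hit => ?_⟩
  · rw [Finset.card_compl, Fintype.card_fin]
    have := hc t₀
    omega
  · refine Finset.mem_compl.1 hi ?_
    have h1 : (r t₀).faulty = (r (max t₀ t)).faulty := h _ (le_max_left _ _)
    rw [h1]
    exact hr.faulty_mono (le_max_right t₀ t) hit

theorem eventually_subset_S (hr : IsGatherRun f validate r) (hF : IsGatherFair f r) {t : ℕ}
    {p q : Fin n} (hp : p ∉ (r t).faulty) (hq : ∀ t, q ∉ (r t).faulty) {A : Finset (Fin n)}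
    (hA : A ⊆ ((r t).party p).S) : ∀ᶠ t' in atTop, A ⊆ ((r t').party q).S := by
  have h : ∀ j ∈ A, ∀ᶠ t' in atTop, j ∈ ((r t').party q).S := fun j hj => by
    obtain ⟨x, hx⟩ := ((hr.wellFormed t p).mem_S j).1 (hA hj)
    filter_upwards [BroadcastTrace.eventually_output (hr.agreement1 j) (hF.termination1 j)
      (fun i v t t' h => (hr.le i h).rcvd1 j v) hp hx hq] with t' ht'
    exact ((hr.wellFormed t' q).mem_S j).2 ⟨x, ht'⟩
  exact (eventually_all_finset A).2 h

theorem eventually_mem_T (hr : IsGatherRun f validate r) (hF : IsGatherFair f r) {t : ℕ}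
    {p q k : Fin n} (hp : p ∉ (r t).faulty) (hq : ∀ t, q ∉ (r t).faulty) {A : Finset (Fin n)}
    (hk : ∀ᶠ t' in atTop, ((r t').party q).rcvd2 k = some A) (hc : n - f ≤ A.card)
    (hA : A ⊆ ((r t).party p).S) : ∀ᶠ t' in atTop, k ∈ ((r t').party q).T := by
  obtain ⟨t₁, h₁, h₂⟩ := (hk.and (hr.eventually_subset_S hF hp hq hA)).exists
  obtain ⟨t₂, h⟩ := hF.accept2 q hq t₁ k ⟨A, h₁, hc, h₂⟩
  exact eventually_atTop.2 ⟨t₂, fun t' h' => (hr.le q h').T h⟩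

theorem eventually_subset_T (hr : IsGatherRun f validate r) (hF : IsGatherFair f r) {t : ℕ}
    {p q : Fin n} (hp : p ∉ (r t).faulty) (hq : ∀ t, q ∉ (r t).faulty) {A : Finset (Fin n)}
    (hA : A ⊆ ((r t).party p).T) : ∀ᶠ t' in atTop, A ⊆ ((r t').party q).T := by
  have h : ∀ j ∈ A, ∀ᶠ t' in atTop, j ∈ ((r t').party q).T := fun j hj => by
    obtain ⟨B, hB, hc, hBS⟩ := (hr.wellFormed t p).mem_T j (hA hj)
    exact hr.eventually_mem_T hF hp hq (BroadcastTrace.eventually_output (hr.agreement2 j)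
      (hF.termination2 j) (fun i v t t' h => (hr.le i h).rcvd2 j v) hp hB hq) hc hBS
  exact (eventually_all_finset A).2 h

theorem eventually_mem_U (hr : IsGatherRun f validate r) (hF : IsGatherFair f r) {t : ℕ}
    {p q k : Fin n} (hp : p ∉ (r t).faulty) (hq : ∀ t, q ∉ (r t).faulty) {A : Finset (Fin n)}
    (hk : ∀ᶠ t' in atTop, ((r t').party q).rcvd3 k = some A) (hc : n - f ≤ A.card)
    (hA : A ⊆ ((r t).party p).T) :
    ∀ᶠ t' in atTop, (k, ((r t).party p).unionOf A) ∈ ((r t').party q).U := by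
  obtain ⟨t₁, h₁, h₂⟩ := (hk.and (hr.eventually_subset_T hF hp hq hA)).exists
  obtain ⟨t₂, h⟩ := hF.accept3 q hq t₁ k A ⟨h₁, hc, h₂⟩
  obtain ⟨V, hV⟩ := mem_indices.1 h
  filter_upwards [eventually_ge_atTop t₂, hk] with t' ht' hk'
  have hV' := (hr.le q ht').U hV
  obtain ⟨A', hA', rfl⟩ := (hr.wellFormed t' q).mem_U k V hV'
  obtain rfl : A = A' := Option.some.inj (hk'.symm.trans hA'.1)
  rwa [← hr.unionOf_eq hp (hq t') hA hA'.2.2]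

theorem eventually_verify (hr : IsGatherRun f validate r) (hF : IsGatherFair f r) {t : ℕ}
    {p q : Fin n} (hp : p ∉ (r t).faulty) (hq : ∀ t, q ∉ (r t).faulty) {I : Finset (Fin n)}
    {X : Finset (Fin n × M)} (h : ((r t).party p).gatherVerify f I = some X) :
    ∀ᶠ t' in atTop, ((r t').party q).gatherVerify f I = some X := by
  have hwp := hr.wellFormed t p
  obtain ⟨hU, hI, rfl⟩ := gatherVerify_eq_some.1 h
  have h1 : ∀ y ∈ ((r t).party p).U, ∀ᶠ t' in atTop, y ∈ ((r t').party q).U := by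
    rintro ⟨k, V⟩ hV
    obtain ⟨A, ⟨hA, hc, hAT⟩, rfl⟩ := hwp.mem_U k V hV
    exact hr.eventually_mem_U hF hp hq (BroadcastTrace.eventually_output (hr.agreement3 k)
      (hF.termination3 k) (fun i v t t' h => (hr.le i h).rcvd3 k v) hp hA hq) hc hAT
  filter_upwards [(eventually_all_finset _).2 h1, hr.eventually_subset_S hF hp hq hI]
    with t' hU' hI'
  have hwq := hr.wellFormed t' q
  refine gatherVerify_eq_some.2 ⟨hU.trans (Finset.card_le_card ?_), hI', ?_⟩
  · exact Finset.image_subset_image (Finset.filter_subset_filter _ hU')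
  · ext ⟨j, x⟩
    simp only [Finset.mem_filter, hwp.mem_R, hwq.mem_R, and_congr_left_iff]
    intro hj
    obtain ⟨y, hy⟩ := (hwp.mem_S j).1 (hI hj)
    obtain ⟨z, hz⟩ := (hwq.mem_S j).1 (hI' hj)
    obtain rfl := hr.agreement1 j t t' p q y z hp (hq t') hy hz
    rw [hy, hz]

/-- The parties that stay nonfaulty drive each other through the rounds: the messages of each
round arrive and become acceptable, so that the sets `S`, `T`, `U` reach size `n - f` one after
the other. -/
theorem exists_output (hr : IsGatherRun f validate r) (hF : IsGatherFair f r) (hf : f < n)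
    (hc : ∀ t, (r t).faulty.card ≤ f)
    (hstart : ∀ i, (∀ t, i ∉ (r t).faulty) → ∃ t x, ((r t).party i).input = some x)
    {i : Fin n} (hi : ∀ t, i ∉ (r t).faulty) : ∃ t X, ((r t).party i).output = some X := by
  obtain ⟨H, hHc, hH⟩ := hr.exists_nonfaulty hc
  have h2 : ∀ q, (∀ t, q ∉ (r t).faulty) → ∃ t A, ((r t).party q).bcast2 = some A := by
    intro q hq
    have h : ∀ j ∈ H, ∀ᶠ t in atTop, j ∈ ((r t).party q).S := fun j hj => by
      obtain ⟨t, x, hx⟩ := hstart j (hH j hj)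
      obtain ⟨v, -, -, h⟩ := BroadcastTrace.eventually_output_of_dealer (hr.validity1 j)
        (hF.termination1 j) (fun i v t t' h => (hr.le i h).rcvd1 j v) (hH j hj)
        ⟨t, x, (hr.emits hf t j).bcast1.trans hx⟩ hq
      filter_upwards [h] with t ht
      exact ((hr.wellFormed t q).mem_S j).2 ⟨v, ht⟩
    obtain ⟨t, ht⟩ := ((eventually_all_finset H).2 h).exists
    exact ⟨t, (hr.emits hf t q).bcast2_isSome (hHc.trans (Finset.card_le_card ht))⟩
  have h3 : ∀ q, (∀ t, q ∉ (r t).faulty) → ∃ t A, ((r t).party q).bcast3 = some A := by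
    intro q hq
    have h : ∀ j ∈ H, ∀ᶠ t in atTop, j ∈ ((r t).party q).T := fun j hj => by
      obtain ⟨A, t, hA, h⟩ := BroadcastTrace.eventually_output_of_dealer (hr.validity2 j)
        (hF.termination2 j) (fun i v t t' h => (hr.le i h).rcvd2 j v) (hH j hj)
        (h2 j (hH j hj)) hq
      obtain ⟨hAc, hAS⟩ := (hr.emits hf t j).bcast2 A hA
      exact hr.eventually_mem_T hF (hH j hj t) hq h hAc hAS
    obtain ⟨t, ht⟩ := ((eventually_all_finset H).2 h).exists
    exact ⟨t, (hr.emits hf t q).bcast3_isSome (hHc.trans (Finset.card_le_card ht))⟩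
  have h : ∀ j ∈ H, ∀ᶠ t in atTop, j ∈ indices ((r t).party i).U := fun j hj => by
    obtain ⟨A, t, hA, h⟩ := BroadcastTrace.eventually_output_of_dealer (hr.validity3 j)
      (hF.termination3 j) (fun i v t t' h => (hr.le i h).rcvd3 j v) (hH j hj)
      (h3 j (hH j hj)) hi
    obtain ⟨hAc, hAT⟩ := (hr.emits hf t j).bcast3 A hA
    filter_upwards [hr.eventually_mem_U hF (hH j hj t) hi h hAc hAT] with t' ht'
    exact mem_indices.2 ⟨_, ht'⟩
  obtain ⟨t, ht⟩ := ((eventually_all_finset H).2 h).exists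
  refine ⟨t, (hr.emits hf t i).output_isSome ?_⟩
  rw [← (hr.wellFormed t i).card_indices_U]
  exact hHc.trans (Finset.card_le_card ht)

end IsGatherRun

/-! ### Verifiable gather -/

open LocalState in
/-- The core is what `p`, a party with the first output, has received from the members of the
round-2 set of an index `i` that lies in `f + 1` of the round-3 sets accepted by `p`. -/
theorem gather_isVerifiableGather {n f : ℕ} (hf : 3 * f < n) {M : Type*} [DecidableEq M]
    (validate : M → Bool) : IsVerifiableGather (gather n f validate) f validate := by
  have hfn : f < n := by omega
  have key : ∀ r, (gather n f validate).Admissible f validate r → ∀ t i X,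
      (gather n f validate).Outputs r t i X →
      (gather n f validate).Verifies r t i (indices X) X := fun r hr t i X h =>
    ⟨h.1, (IsGatherRun.emits hr.run hfn t i).output X h.2⟩
  have verify_agree : ∀ r, (gather n f validate).Admissible f validate r →
      (gather n f validate).Fair r → ∀ i j t I X, (gather n f validate).Verifies r t i I X →
      (gather n f validate).StaysNonfaulty r j →
      (gather n f validate).EventuallyVerifies r j I X := fun r hr hF i j t I X h hj =>
    Filter.eventually_atTop.1 (IsGatherRun.eventually_verify hr.run hF h.1 hj h.2)
  refine ⟨fun r hr t i X h => ?_, fun r hr t i I X h => ?_, fun r hr t ht => ?_,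
    fun r hr hF hS i hi => ?_, fun r hr hF _ i j t X hi h => ?_,
    fun r hr hF _ i j t I X h hj => ?_, fun r hr t t' i j I J X Y hX hY k x y hx hy => ?_,
    fun r hr t i I X h j x hx => ?_⟩
  · exact (isGatherSet_of_gatherVerify hfn (IsGatherRun.wellFormed hr.run t i)
      (key r hr t i X h).2).1
  · exact isGatherSet_of_gatherVerify hfn (IsGatherRun.wellFormed hr.run t i) h.2
  · obtain ⟨⟨p, X, hX⟩, -⟩ := ht
    have hrun : IsGatherRun f validate r := hr.run
    have hp : p ∉ (r t).faulty := hX.1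
    have hw := hrun.wellFormed t p
    have hver : ((r t).party p).gatherVerify f (indices X) = some X := (key r hr t p X hX).2
    obtain ⟨i, hi⟩ := hw.exists_inManyTSets hf (card_indices_U_of_gatherVerify hver)
    obtain ⟨B, hB, hBc, hBS⟩ : ((r t).party p).Acceptable2 f i := by
      obtain ⟨K, hKc, hK⟩ := hi
      obtain ⟨k, hk⟩ : K.Nonempty := Finset.card_pos.1 (by omega)
      obtain ⟨hkU, A, hA, hiA⟩ := hK k hk
      obtain ⟨V, hV⟩ := mem_indices.1 hkU
      obtain ⟨A', hA', -⟩ := hw.mem_U k V hV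
      obtain rfl : A = A' := Option.some.inj (hA.symm.trans hA'.1)
      exact hw.mem_T i (hA'.2.2 hiA)
    have hincl : (gather n f validate).IncludesCore f validate r t
        (((r t).party p).R.filter fun y => y.1 ∈ B) := by
      intro r' hr' hrr' t' q I Y hY
      have e : r' t = r t := hrr' t le_rfl
      have := IsGatherRun.core_subset (p := p) (i := i) (B := B) (t := t) hr'.run
        (e.symm ▸ hp) hY.1 (e.symm ▸ hi) (e.symm ▸ hB) hY.2
      rwa [e] at this
    refine ⟨_, ⟨?_, fun j x y hx hy => ?_⟩, ?_, fun j x hx hj => ?_, hincl⟩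
    · refine hBc.trans (le_trans (Finset.card_le_card fun j hj => ?_)
        (Finset.card_image_le (f := Prod.fst)))
      obtain ⟨x, hx⟩ := (hw.mem_S j).1 (hBS hj)
      exact Finset.mem_image.2 ⟨(j, x), Finset.mem_filter.2 ⟨(hw.mem_R j x).2 hx, hj⟩, rfl⟩
    · have hx' := (hw.mem_R j x).1 (Finset.mem_filter.1 hx).1
      have hy' := (hw.mem_R j y).1 (Finset.mem_filter.1 hy).1
      exact Option.some.inj (hx'.symm.trans hy')
    · exact fun r' hr' hrr' t' q Y hY => hincl r' hr' hrr' t' q _ Y (key r' hr' t' q Y hY)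
    · have hx' := (hw.mem_R j x).1 (Finset.mem_filter.1 hx).1
      exact (hrun.emits hfn t j).bcast1.symm.trans (hrun.validity1 j t p x hp hj hx')
  · obtain ⟨t, X, h⟩ := IsGatherRun.exists_output hr.run hF hfn hr.corruptions hS hi
    exact ⟨t, X, hi t, h⟩
  · exact verify_agree r hr hF j i t _ X (key r hr t j X h) hi
  · exact verify_agree r hr hF i j t I X h hj
  · exact IsGatherRun.verify_agreement hr.run hX.1 hY.1 hX.2 hY.2 hx hy
  · have hrun : IsGatherRun f validate r := hr.run
    exact hrun.externalValidity1 j t i x h.1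
      ((mem_of_gatherVerify (hrun.wellFormed t i) h.2).1 hx).1

end VerifiableGather

theorem mainTheorem4 (n f : ℕ) (hf : 3 * f < n) {M : Type*} [DecidableEq M]
    (validate : M → Bool) :
    VerifiableGather.IsVerifiableGather (VerifiableGather.gather n f validate) f validate ∧
      n * f < (n - f) ^ 2 ∧
      ∀ r : ℕ → VerifiableGather.GlobalState n M,
        (VerifiableGather.gather n f validate).Admissible f validate r →
        ∀ t p X, (VerifiableGather.gather n f validate).Outputs r t p X →
          ∃ i, VerifiableGather.InManyTSets f ((r t).party p) i := by
  refine ⟨VerifiableGather.gather_isVerifiableGather hf validate,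
    VerifiableGather.mul_lt_sub_sq hf, fun r hr t p X h => ?_⟩
  have hrun : VerifiableGather.IsGatherRun f validate r := hr.run
  exact (hrun.wellFormed t p).exists_inManyTSets hf
    (VerifiableGather.LocalState.card_indices_U_of_gatherVerify
      ((hrun.emits (by omega) t p).output X h.2))
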